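/- Consider a single-input single-output discrete-time LTI system described by a nonzero proper real rational transfer function $G(z)$ with minimal order $n\ge 1$ (the least state dimension of a state-space realization of $G$), lag $l$ (the observability index of a minimal realization, i.e. the least $i$ such that the matrix with rows $C, CA,\ldots, CA^{i-1}$ has rank $n$) and relative degree $\nu\ge 0$. For $k\ge 1$, let $\mathcal{W}_k\subset\mathbb{R}^{2k}$ be the set of all length-$k$ input-output trajectories $\operatorname{col}(u,y)$ of the system, i.e. of a minimal realization $x(t+1)=Ax(t)+Bu(t)$, $y(t)=Cx(t)+Du(t)$ of $G$ with arbitrary initial state; for an integer $L\ge 0$, let $\mathcal{W}_k^L$ be the set of $\operatorname{col}(u,y)$ with $u\in\mathbb{R}^k$, $y\in\mathbb{R}^{k+L}$ such that $\operatorname{col}(u,u',y)\in\mathcal{W}_{k+L}$ for some $u'\in\mathbb{R}^L$. For $w=\operatorname{col}(w_0,\ldots,w_{T-1})\in\mathbb{R}^T$ and $1\le j\le T$, let $\mathcal{H}_j(w)\in\mathbb{R}^{j\times(T-j+1)}$ be the Hankel matrix whose entry in row $i$ and column $c$ (both counted from $0$) is $w_{i+c}$. Let $L\ge\nu$, $N\ge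 l$, and let $\operatorname{col}(u^{\mathrm d},y^{\mathrm d})\in\mathcal{W}_k^L$ with $u^{\mathrm d}\in\mathbb{R}^k$, $y^{\mathrm d}\in\mathbb{R}^{k+L}$. If $u^{\mathrm d}$ is persistently exciting of order $n+N+L+1$, i.e. $k\ge n+N+L+1$ and $\mathcal{H}_{n+N+L+1}(u^{\mathrm d})$ has full row rank, then $$\operatorname{rank}\begin{bmatrix}\mathcal{H}_{N+1}(u^{\mathrm d})\\ \mathcal{H}_{N+L+1}(y^{\mathrm d})\end{bmatrix}=N+n+L-\nu+1.$$ -/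

import Mathlib

noncomputable section

open scoped Matrix

/-- A single-input single-output discrete-time linear time-invariant state-space model
`x(t+1) = A x(t) + B u(t)`, `y(t) = C x(t) + D u(t)` with `d`-dimensional state. -/
structure StateSpace (d : ℕ) where
  A : Matrix (Fin d) (Fin d) ℝ
  B : Fin d → ℝ
  C : Fin d → ℝ
  D : ℝ

namespace StateSpace

variable {d : ℕ}

/-- The transfer function `C (z I - A)⁻¹ B + D`, as a rational function of `z`. The matrix
`z I - A` is always invertible over the field of rational functions. -/
def transferFunction (S : StateSpace d) : RatFunc ℝ :=
  (fun i => (RatFunc.C (S.C i) : RatFunc ℝ)) ⬝ᵥ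
      (((RatFunc.X : RatFunc ℝ) • (1 : Matrix (Fin d) (Fin d) (RatFunc ℝ))
          - S.A.map (RatFunc.C : ℝ →+* RatFunc ℝ))⁻¹ *ᵥ
        (fun i => RatFunc.C (S.B i)))
    + RatFunc.C S.D

/-- The matrix with rows `C, C A, …, C A ^ (i - 1)`. -/
def obsMatrix (S : StateSpace d) (i : ℕ) : Matrix (Fin i) (Fin d) ℝ :=
  Matrix.of fun r => S.C ᵥ* S.A ^ (r : ℕ)

/-- The observability index: the least `i` for which the matrix with rows `C, …, C A ^ (i - 1)`
has the rank of the full observability matrix (which is `d` if the model is observable). -/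
def observabilityIndex (S : StateSpace d) : ℕ :=
  sInf {i | (S.obsMatrix i).rank = (S.obsMatrix d).rank}

/-- The input-output trajectories `(u(0), …, u(k-1))`, `(y(0), …, y(k-1))` of length `k`, with
arbitrary initial state. -/
def trajectories (S : StateSpace d) (k : ℕ) : Set ((Fin k → ℝ) × (Fin k → ℝ)) :=
  {w | ∃ x : ℕ → Fin d → ℝ, ∀ t : Fin k,
    x (t + 1) = S.A *ᵥ x t + w.1 t • S.B ∧ w.2 t = S.C ⬝ᵥ x t + S.D * w.1 t}

end StateSpace

/-- A transfer function is proper if the degree of its numerator does not exceed that of its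
denominator. -/
def IsProper (G : RatFunc ℝ) : Prop :=
  G.num.natDegree ≤ G.denom.natDegree

/-- The relative degree of a (nonzero, proper) transfer function. -/
def relativeDegree (G : RatFunc ℝ) : ℕ :=
  G.denom.natDegree - G.num.natDegree

/-- `n` is the minimal order of `G`: the least state dimension of a model with transfer
function `G`. -/
def IsMinimalOrder (G : RatFunc ℝ) (n : ℕ) : Prop :=
  IsLeast {d : ℕ | ∃ S : StateSpace d, S.transferFunction = G} n

/-- `S` is a minimal realization of `G`. -/
def StateSpace.IsMinimalRealization {d : ℕ} (S : StateSpace d) (G : RatFunc ℝ) : Prop :=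
  S.transferFunction = G ∧ IsMinimalOrder G d

/-- `l` is the lag of `G`: the observability index of a minimal realization. -/
def IsLag (G : RatFunc ℝ) (l : ℕ) : Prop :=
  ∃ (d : ℕ) (S : StateSpace d), S.IsMinimalRealization G ∧ S.observabilityIndex = l

/-- The set of length-`k` input-output trajectories of the system with transfer function `G`,
that is, of a minimal realization of `G`. (Minimal realizations differ only by a change of
coordinates of the state, so they all have the same trajectories.) -/
def systemTrajectories (G : RatFunc ℝ) (k : ℕ) : Set ((Fin k → ℝ) × (Fin k → ℝ)) :=
  {w | ∃ (d : ℕ) (S : StateSpace d), S.IsMinimalRealization G ∧ w ∈ S.trajectories k}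

/-- The set of pairs of an input of length `k` and an output of length `k + L` for which the
input can be continued by `L` further samples to a trajectory of length `k + L`. -/
def delayTrajectories (G : RatFunc ℝ) (k L : ℕ) : Set ((Fin k → ℝ) × (Fin (k + L) → ℝ)) :=
  {w | ∃ u' : Fin L → ℝ, (Fin.append w.1 u', w.2) ∈ systemTrajectories G (k + L)}

/-- The Hankel matrix with `j` rows of a signal of length `T`: its `(i, c)` entry is
`w (i + c)`, and it has `T - j + 1` columns (none if `T < j`). -/
def hankel {T : ℕ} (j : ℕ) (w : Fin T → ℝ) : Matrix (Fin j) (Fin (T + 1 - j)) ℝ :=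
  Matrix.of fun i c => w ⟨i + c, by omega⟩

/-- `w` is persistently exciting of order `j`: its Hankel matrix with `j` rows has full row
rank. -/
def IsPersistentlyExciting {T : ℕ} (j : ℕ) (w : Fin T → ℝ) : Prop :=
  j ≤ T ∧ (hankel j w).rank = j

/-- The Hankel matrix of `u` with `N + 1` rows on top of the Hankel matrix of `y` with
`N + L + 1` rows; both have `k - N` columns. -/
def stackedHankel {k : ℕ} (N L : ℕ) (u : Fin k → ℝ) (y : Fin (k + L) → ℝ) :
    Matrix (Fin (N + 1) ⊕ Fin (N + L + 1)) (Fin (k + 1 - (N + 1))) ℝ :=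
  Matrix.fromRows (hankel (N + 1) u)
    ((hankel (N + L + 1) y).submatrix id
      (Fin.cast (show k + 1 - (N + 1) = k + L + 1 - (N + L + 1) by omega)))

end

/-! Write h_i for the Markov parameters. The first nonzero one is h_ν, so outputs over N+L+1 steps
do not see the last ν inputs. The data matrix therefore factors as P Z: column t of Z is the state
x(t) on top of the next N+L+1-ν inputs, and P (`responseMatrix`) sends these to N+1 inputs and N+L+1
outputs. The rank is the inner dimension n+N+L+1-ν, because P is injective and Z has full row rank.

Injectivity of P (`responseMatrix_injective`) comes from observability and h_ν ≠ 0. Full row rank of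
Z (`vecMul_stateInputMatrix_eq_zero`) is Willems' fundamental lemma: it needs controllability and
persistent excitation. Observability and controllability follow from minimality, and N ≥ n because a
single output needs n rows of C A^i to reach rank n. -/

noncomputable section

open scoped Matrix

/-! ### Transfer function, Markov parameters and relative degree -/

namespace StateSpace

variable {d : ℕ}

/-- The Markov parameters `D, C B, C A B, …`, that is, the impulse response. -/
def markov (S : StateSpace d) : ℕ → ℝ
  | 0 => S.D
  | i + 1 => S.C ⬝ᵥ S.A ^ i *ᵥ S.B

/-- The polynomial part of `q(z) ∑ j, h j * z ^ (-j)`. -/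
def _root_.polynomialPart (h : ℕ → ℝ) (q : Polynomial ℝ) : Polynomial ℝ :=
  ∑ i ∈ Finset.range (q.natDegree + 1), ∑ j ∈ Finset.range (i + 1),
    Polynomial.monomial (i - j) (q.coeff i * h j)

/-- The resolvent `(z I - A)⁻¹`. -/
def resolvent (S : StateSpace d) : Matrix (Fin d) (Fin d) (RatFunc ℝ) :=
  ((RatFunc.X : RatFunc ℝ) • (1 : Matrix (Fin d) (Fin d) (RatFunc ℝ))
    - S.A.map (RatFunc.C : ℝ →+* RatFunc ℝ))⁻¹

lemma X_smul_resolvent (S : StateSpace d) :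
    (RatFunc.X : RatFunc ℝ) • S.resolvent
      = 1 + S.A.map (RatFunc.C : ℝ →+* RatFunc ℝ) * S.resolvent := by
  have hdet : IsUnit ((RatFunc.X : RatFunc ℝ) • (1 : Matrix (Fin d) (Fin d) (RatFunc ℝ))
      - S.A.map (RatFunc.C : ℝ →+* RatFunc ℝ)).det := by
    have h : (RatFunc.X : RatFunc ℝ) • (1 : Matrix (Fin d) (Fin d) (RatFunc ℝ))
        - S.A.map (RatFunc.C : ℝ →+* RatFunc ℝ)
        = (algebraMap (Polynomial ℝ) (RatFunc ℝ)).mapMatrix S.A.charmatrix := by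
      ext i j
      by_cases hij : i = j
      · subst hij
        simp [Matrix.charmatrix_apply_eq, RatFunc.algebraMap_X, RatFunc.algebraMap_C]
      · simp [hij, RatFunc.algebraMap_C]
    rw [h, ← RingHom.map_det, isUnit_iff_ne_zero]
    exact RatFunc.algebraMap_ne_zero S.A.charpoly_monic.ne_zero
  have := Matrix.mul_nonsing_inv _ hdet
  rw [Matrix.sub_mul, Matrix.smul_mul, Matrix.one_mul, sub_eq_iff_eq_add] at this
  exact this

lemma map_C_dotProduct_mulVec (S : StateSpace d) (M : Matrix (Fin d) (Fin d) ℝ) :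
    (fun i => (RatFunc.C (S.C i) : RatFunc ℝ)) ⬝ᵥ
      (M.map (RatFunc.C : ℝ →+* RatFunc ℝ) *ᵥ fun i => RatFunc.C (S.B i))
      = RatFunc.C (S.C ⬝ᵥ M *ᵥ S.B) := by
  simp [dotProduct, Matrix.mulVec]

/-- Iterating z R = 1 + A R for the resolvent R splits off one Markov parameter at each step. -/
lemma X_pow_mul_transferFunction (S : StateSpace d) (i : ℕ) :
    RatFunc.X ^ i * S.transferFunction
      = ∑ j ∈ Finset.range (i + 1), RatFunc.C (S.markov j) * RatFunc.X ^ (i - j)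
        + (fun i => (RatFunc.C (S.C i) : RatFunc ℝ)) ⬝ᵥ
          (((S.A ^ i).map (RatFunc.C : ℝ →+* RatFunc ℝ) * S.resolvent) *ᵥ
            fun i => RatFunc.C (S.B i)) := by
  induction i with
  | zero =>
    simp only [transferFunction, resolvent, markov, pow_zero, one_mul, zero_add,
      Finset.range_one, Finset.sum_singleton, Nat.sub_self, mul_one]
    rw [Matrix.map_one _ (map_zero _) (map_one _), one_mul, add_comm]
  | succ i ih =>
    rw [pow_succ', mul_assoc, ih, mul_add, Finset.sum_range_succ _ (i + 1), add_assoc,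
      Finset.mul_sum]
    congr 1
    · refine Finset.sum_congr rfl fun j hj => ?_
      rw [Finset.mem_range] at hj
      rw [show i + 1 - j = (i - j) + 1 by omega, pow_succ']
      ring
    · rw [← smul_eq_mul, ← dotProduct_smul, ← Matrix.smul_mulVec, ← Matrix.mul_smul,
        X_smul_resolvent, Matrix.mul_add, Matrix.mul_one, ← mul_assoc, ← Matrix.map_mul,
        ← pow_succ, Matrix.add_mulVec, dotProduct_add, map_C_dotProduct_mulVec]
      simp [markov]

/-- The remainders C A^i R B, weighted by the coefficients of q, add up to C q(A) R B = 0. -/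
lemma algebraMap_mul_transferFunction (S : StateSpace d) (q : Polynomial ℝ)
    (hq : Polynomial.aeval S.A q = 0) :
    algebraMap (Polynomial ℝ) (RatFunc ℝ) q * S.transferFunction
      = algebraMap (Polynomial ℝ) (RatFunc ℝ) (polynomialPart S.markov q) := by
  have hz : ∑ i ∈ Finset.range (q.natDegree + 1), RatFunc.C (q.coeff i) *
      ((fun i => (RatFunc.C (S.C i) : RatFunc ℝ)) ⬝ᵥ
          (((S.A ^ i).map (RatFunc.C : ℝ →+* RatFunc ℝ) * S.resolvent) *ᵥ
            fun i => RatFunc.C (S.B i))) = 0 := by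
    have h0 : ∑ i ∈ Finset.range (q.natDegree + 1),
        (RatFunc.C (q.coeff i) : RatFunc ℝ) • (S.A ^ i).map (RatFunc.C : ℝ →+* RatFunc ℝ) = 0 := by
      rw [Polynomial.aeval_eq_sum_range] at hq
      have := congrArg (fun M => M.map (RatFunc.C : ℝ →+* RatFunc ℝ)) hq
      ext a b
      have := congrFun (congrFun this a) b
      simpa [Matrix.sum_apply] using this
    have hterm : ∀ i, RatFunc.C (q.coeff i) *
        ((fun i => (RatFunc.C (S.C i) : RatFunc ℝ)) ⬝ᵥ
          (((S.A ^ i).map (RatFunc.C : ℝ →+* RatFunc ℝ) * S.resolvent) *ᵥ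
            fun i => RatFunc.C (S.B i)))
        = (fun i => (RatFunc.C (S.C i) : RatFunc ℝ)) ⬝ᵥ
          ((((RatFunc.C (q.coeff i) : RatFunc ℝ) •
            (S.A ^ i).map (RatFunc.C : ℝ →+* RatFunc ℝ)) * S.resolvent) *ᵥ
            fun i => RatFunc.C (S.B i)) := fun i => by
      rw [Matrix.smul_mul, Matrix.smul_mulVec, dotProduct_smul, smul_eq_mul]
    rw [Finset.sum_congr rfl fun i _ => hterm i, ← dotProduct_sum, ← Matrix.sum_mulVec,
      ← Finset.sum_mul, h0]
    simp
  conv_lhs => rw [q.as_sum_range]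
  rw [map_sum, Finset.sum_mul, polynomialPart, map_sum]
  refine Eq.trans ?_ (add_zero _)
  rw [← hz, ← Finset.sum_add_distrib]
  refine Finset.sum_congr rfl fun i _ => ?_
  rw [← Polynomial.C_mul_X_pow_eq_monomial, map_mul, map_pow, RatFunc.algebraMap_C,
    RatFunc.algebraMap_X, mul_assoc, X_pow_mul_transferFunction, mul_add, Finset.mul_sum, map_sum]
  congr 1
  refine Finset.sum_congr rfl fun j _ => ?_
  rw [← Polynomial.C_mul_X_pow_eq_monomial, map_mul, map_pow, RatFunc.algebraMap_C,
    RatFunc.algebraMap_X, map_mul, mul_assoc]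

/-- The product of the two characteristic polynomials annihilates both state matrices, so it clears
both denominators at once. -/
lemma transferFunction_eq_of_markov_eq {e : ℕ} (S : StateSpace d) (S' : StateSpace e)
    (h : S.markov = S'.markov) : S.transferFunction = S'.transferFunction := by
  set q := S.A.charpoly * S'.A.charpoly
  have hq : q ≠ 0 := (S.A.charpoly_monic.mul S'.A.charpoly_monic).ne_zero
  have h1 := S.algebraMap_mul_transferFunction q (by simp [q, Matrix.aeval_self_charpoly])
  have h2 := S'.algebraMap_mul_transferFunction q (by simp [q, Matrix.aeval_self_charpoly])
  rw [h, ← h2] at h1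
  exact mul_left_cancel₀ (RatFunc.algebraMap_ne_zero hq) h1

lemma _root_.coeff_polynomialPart (h : ℕ → ℝ) (q : Polynomial ℝ) (m : ℕ) :
    (polynomialPart h q).coeff m = ∑ i ∈ Finset.range (q.natDegree + 1),
      if m ≤ i then q.coeff i * h (i - m) else 0 := by
  rw [polynomialPart, Polynomial.finsetSum_coeff]
  refine Finset.sum_congr rfl fun i _ => ?_
  rw [Polynomial.finsetSum_coeff]
  simp_rw [Polynomial.coeff_monomial]
  split_ifs with hm
  · rw [Finset.sum_eq_single (i - m)]
    · rw [if_pos (by omega)]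
    · intro j hj hne
      rw [Finset.mem_range] at hj
      rw [if_neg (by omega)]
    · intro hj
      simp at hj
  · refine Finset.sum_eq_zero fun j _ => if_neg (by omega)

/-- The index of the first nonzero Markov parameter is the relative degree. -/
lemma markov_relativeDegree (S : StateSpace d) (hG : S.transferFunction ≠ 0) :
    (∀ i < relativeDegree S.transferFunction, S.markov i = 0) ∧
      S.markov (relativeDegree S.transferFunction) ≠ 0 := by
  classical
  set G := S.transferFunction with hGdef
  set q := S.A.charpoly
  have hq : q.Monic := S.A.charpoly_monic
  have hP := S.algebraMap_mul_transferFunction q S.A.aeval_self_charpoly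
  have hP0 : polynomialPart S.markov q ≠ 0 := by
    intro h0
    rw [h0, map_zero] at hP
    exact (mul_ne_zero (RatFunc.algebraMap_ne_zero hq.ne_zero) hG) hP
  have hex : ∃ r, r ≤ q.natDegree ∧ S.markov r ≠ 0 := by
    by_contra! hcon
    refine hP0 (Polynomial.ext fun m => ?_)
    rw [coeff_polynomialPart, Polynomial.coeff_zero]
    refine Finset.sum_eq_zero fun i hi => ?_
    rw [Finset.mem_range] at hi
    split_ifs
    · rw [hcon _ (by omega), mul_zero]
    · rfl
  set r := Nat.find hex with hr
  obtain ⟨hrn, hr0⟩ : r ≤ q.natDegree ∧ S.markov r ≠ 0 := Nat.find_spec hex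
  have hlt : ∀ i < r, S.markov i = 0 := by
    intro i hi
    by_contra hne
    exact Nat.find_min hex hi ⟨by omega, hne⟩
  -- The top coefficient is that of q, namely 1, times the first nonzero Markov parameter h_r.
  have hdeg : (polynomialPart S.markov q).natDegree = q.natDegree - r := by
    refine Polynomial.natDegree_eq_of_le_of_coeff_ne_zero ?_ ?_
    · rw [Polynomial.natDegree_le_iff_coeff_eq_zero]
      intro m hm
      rw [coeff_polynomialPart]
      refine Finset.sum_eq_zero fun i hi => ?_
      rw [Finset.mem_range] at hi
      split_ifs
      · rw [hlt _ (by omega), mul_zero]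
      · rfl
    · rw [coeff_polynomialPart, Finset.sum_range_succ, Finset.sum_eq_zero, zero_add,
        if_pos (by omega), hq.coeff_natDegree, one_mul, Nat.sub_sub_self hrn]
      · exact hr0
      · intro i hi
        rw [Finset.mem_range] at hi
        split_ifs
        · rw [hlt _ (by omega), mul_zero]
        · rfl
  have hrel : relativeDegree G = r := by
    have hcross : q * G.num = polynomialPart S.markov q * G.denom := by
      apply RatFunc.algebraMap_injective ℝ
      rw [map_mul, map_mul, ← hP, ← hGdef, mul_assoc]
      congr 1
      rw [← div_eq_iff (RatFunc.algebraMap_ne_zero G.denom_ne_zero), RatFunc.num_div_denom]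
    have := congrArg Polynomial.natDegree hcross
    rw [Polynomial.natDegree_mul hq.ne_zero (RatFunc.num_ne_zero hG),
      Polynomial.natDegree_mul hP0 G.denom_ne_zero, hdeg] at this
    rw [relativeDegree]
    omega
  rw [hrel]
  exact ⟨hlt, hr0⟩

/-! ### Minimality gives observability and controllability -/

lemma _root_.Matrix.dotProduct_pow_mulVec_eq_zero (A : Matrix (Fin d) (Fin d) ℝ)
    (v w : Fin d → ℝ) (h : ∀ i < d, v ⬝ᵥ A ^ i *ᵥ w = 0) (i : ℕ) : v ⬝ᵥ A ^ i *ᵥ w = 0 := by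
  have hdeg : (Polynomial.X ^ i %ₘ A.charpoly).degree < (d : WithBot ℕ) := by
    refine (Polynomial.degree_modByMonic_lt _ A.charpoly_monic).trans_eq ?_
    rw [Matrix.charpoly_degree_eq_dim, Fintype.card_fin]
  -- The range is `d + 1` because `natDegree < d` fails for `d = 0`; the extra coefficient vanishes.
  rw [Matrix.pow_eq_aeval_mod_charpoly,
    Polynomial.aeval_eq_sum_range' (lt_of_le_of_lt le_rfl ?_ : _ < d + 1), Matrix.sum_mulVec,
    dotProduct_sum]
  · refine Finset.sum_eq_zero fun j hj => ?_
    rw [Matrix.smul_mulVec, dotProduct_smul]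
    rcases Nat.lt_or_ge j d with hjd | hjd
    · rw [h j hjd, smul_zero]
    · rw [Polynomial.coeff_eq_zero_of_degree_lt (hdeg.trans_le (by exact_mod_cast hjd)), zero_smul]
  · exact Nat.lt_succ_of_le (Polynomial.natDegree_le_of_degree_le hdeg.le)

/-- If the rows `C A ^ i` do not span, restricting to their span gives a smaller model with the
same impulse response. -/
lemma exists_markov_eq_of_span_ne_top (S : StateSpace d)
    (h : Submodule.span ℝ (Set.range fun i : ℕ => S.C ᵥ* S.A ^ i) ≠ ⊤) :
    ∃ m < d, ∃ S' : StateSpace m, S'.markov = S.markov := by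
  set W := Submodule.span ℝ (Set.range fun i : ℕ => S.C ᵥ* S.A ^ i) with hW
  have hlt : Module.finrank ℝ W < d := by
    simpa using Submodule.finrank_lt h
  have hinv : ∀ w ∈ W, w ᵥ* S.A ∈ W := by
    intro w hw
    have hle : W ≤ W.comap S.A.vecMulLinear := by
      rw [hW, Submodule.span_le]
      rintro _ ⟨i, rfl⟩
      refine Submodule.subset_span ⟨i + 1, ?_⟩
      simp [pow_succ, Matrix.vecMul_vecMul]
    exact hle hw
  have hC : S.C ∈ W := Submodule.subset_span ⟨0, by simp⟩
  let b := Module.finBasis ℝ W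
  let T : Matrix (Fin (Module.finrank ℝ W)) (Fin d) ℝ := Matrix.of fun i => (b i : Fin d → ℝ)
  have hrepr : ∀ w : W, (b.repr w : Fin (Module.finrank ℝ W) → ℝ) ᵥ* T = w := by
    intro w
    have h1 := congrArg Subtype.val (b.sum_repr w)
    rw [Submodule.coe_sum] at h1
    rw [Matrix.vecMul_eq_sum]
    exact h1
  let A' : Matrix (Fin (Module.finrank ℝ W)) (Fin (Module.finrank ℝ W)) ℝ :=
    Matrix.of fun i => (b.repr ⟨(b i : Fin d → ℝ) ᵥ* S.A, hinv _ (b i).2⟩)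
  have hTA : T * S.A = A' * T := by
    ext i j
    exact (congrFun (hrepr ⟨(b i : Fin d → ℝ) ᵥ* S.A, hinv _ (b i).2⟩) j).symm
  have hTpow : ∀ i : ℕ, T * S.A ^ i = A' ^ i * T := by
    intro i
    induction i with
    | zero => simp
    | succ i ih =>
      rw [pow_succ, ← Matrix.mul_assoc, ih, Matrix.mul_assoc, hTA, ← Matrix.mul_assoc, ← pow_succ]
  refine ⟨_, hlt, ⟨A', T *ᵥ S.B, b.repr ⟨S.C, hC⟩, S.D⟩, ?_⟩
  funext i
  cases i with
  | zero => rfl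
  | succ i =>
    change _ ⬝ᵥ A' ^ i *ᵥ (T *ᵥ S.B) = S.C ⬝ᵥ S.A ^ i *ᵥ S.B
    rw [Matrix.mulVec_mulVec, ← hTpow, ← Matrix.mulVec_mulVec, Matrix.dotProduct_mulVec, hrepr]

lemma IsMinimalRealization.observable {S : StateSpace d} {G : RatFunc ℝ}
    (hS : S.IsMinimalRealization G) (x : Fin d → ℝ) (hx : ∀ i < d, S.C ⬝ᵥ S.A ^ i *ᵥ x = 0) :
    x = 0 := by
  have hspan : Submodule.span ℝ (Set.range fun i : ℕ => S.C ᵥ* S.A ^ i) = ⊤ := by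
    by_contra hne
    obtain ⟨m, hm, S', hS'⟩ := S.exists_markov_eq_of_span_ne_top hne
    exact hm.not_ge (hS.2.2 ⟨S', (transferFunction_eq_of_markov_eq _ _ hS').trans hS.1⟩)
  have hle : Submodule.span ℝ (Set.range fun i : ℕ => S.C ᵥ* S.A ^ i)
      ≤ LinearMap.ker ((dotProductBilin ℝ ℝ).flip x) := by
    rw [Submodule.span_le]
    rintro _ ⟨i, rfl⟩
    simpa [← Matrix.dotProduct_mulVec] using S.A.dotProduct_pow_mulVec_eq_zero S.C x hx i
  rw [hspan] at hle
  have hxx : x ⬝ᵥ x = 0 := by simpa using hle (Submodule.mem_top (x := x))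
  exact dotProduct_self_eq_zero.1 hxx

lemma IsMinimalRealization.controllable {S : StateSpace d} {G : RatFunc ℝ}
    (hS : S.IsMinimalRealization G) (x : Fin d → ℝ) (hx : ∀ i < d, x ⬝ᵥ S.A ^ i *ᵥ S.B = 0) :
    x = 0 := by
  -- The dual model has the same Markov parameters, so it is minimal too, and its observability is
  -- the controllability of `S`.
  let S' : StateSpace d := ⟨S.Aᵀ, S.C, S.B, S.D⟩
  have hswap : ∀ (i : ℕ) (v w : Fin d → ℝ), v ⬝ᵥ S.Aᵀ ^ i *ᵥ w = w ⬝ᵥ S.A ^ i *ᵥ v := by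
    intro i v w
    rw [← Matrix.transpose_pow, Matrix.mulVec_transpose, dotProduct_comm, Matrix.dotProduct_mulVec]
  have hmarkov : S'.markov = S.markov := by
    funext i
    cases i with
    | zero => rfl
    | succ i => exact hswap i S.B S.C
  have hS' : S'.IsMinimalRealization G :=
    ⟨(transferFunction_eq_of_markov_eq _ _ hmarkov).trans hS.1, hS.2⟩
  exact hS'.observable x fun i hi => (hswap i S.B x).trans (hx i hi)

/-- The lag of a single-output system is its order. -/
lemma IsMinimalRealization.le_observabilityIndex {S : StateSpace d} {G : RatFunc ℝ}
    (hS : S.IsMinimalRealization G) : d ≤ S.observabilityIndex := by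
  have hrank : (S.obsMatrix d).rank = d := by
    rw [Matrix.rank, LinearMap.finrank_range_of_inj, Module.finrank_fin_fun]
    rw [injective_iff_map_eq_zero]
    intro x hx
    refine hS.observable x fun i hi => ?_
    rw [Matrix.dotProduct_mulVec]
    exact congrFun hx ⟨i, hi⟩
  have hmem : (S.obsMatrix S.observabilityIndex).rank = (S.obsMatrix d).rank :=
    Nat.sInf_mem (s := {i | (S.obsMatrix i).rank = (S.obsMatrix d).rank}) ⟨d, rfl⟩
  rw [hrank] at hmem
  calc d = (S.obsMatrix S.observabilityIndex).rank := hmem.symm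
    _ ≤ S.observabilityIndex := by simpa using (S.obsMatrix S.observabilityIndex).rank_le_height

/-! ### State evolution and persistent excitation -/

/-- The state trajectory from the initial state `x₀` under the input `u`. -/
def state (S : StateSpace d) (x₀ : Fin d → ℝ) (u : ℕ → ℝ) : ℕ → Fin d → ℝ
  | 0 => x₀
  | t + 1 => S.A *ᵥ state S x₀ u t + u t • S.B

lemma dotProduct_state_add (S : StateSpace d) (x₀ : Fin d → ℝ) (u : ℕ → ℝ) (t : ℕ)
    (ξ : Fin d → ℝ) (i : ℕ) :
    ξ ⬝ᵥ S.state x₀ u (t + i) = ξ ⬝ᵥ S.A ^ i *ᵥ S.state x₀ u t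
      + ∑ p ∈ Finset.range i, (ξ ⬝ᵥ S.A ^ (i - 1 - p) *ᵥ S.B) * u (t + p) := by
  induction i generalizing ξ with
  | zero => simp
  | succ i ih =>
    rw [← add_assoc, state, dotProduct_add, Matrix.dotProduct_mulVec, ih, dotProduct_smul,
      Finset.sum_range_succ, pow_succ', ← Matrix.mulVec_mulVec, Matrix.dotProduct_mulVec ξ, add_assoc]
    congr 2
    · refine Finset.sum_congr rfl fun p hp => ?_
      rw [Finset.mem_range] at hp
      rw [show i + 1 - 1 - p = (i - 1 - p) + 1 by omega, pow_succ', ← Matrix.mulVec_mulVec,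
        Matrix.dotProduct_mulVec ξ]
    · simp [mul_comm]

lemma output_add (S : StateSpace d) (x₀ : Fin d → ℝ) (u : ℕ → ℝ) (t i : ℕ) :
    S.C ⬝ᵥ S.state x₀ u (t + i) + S.D * u (t + i) = S.C ⬝ᵥ S.A ^ i *ᵥ S.state x₀ u t
      + ∑ p ∈ Finset.range (i + 1), S.markov (i - p) * u (t + p) := by
  rw [dotProduct_state_add, Finset.sum_range_succ, Nat.sub_self, markov, ← add_assoc]
  congr 2
  refine Finset.sum_congr rfl fun p hp => ?_
  rw [Finset.mem_range] at hp
  rw [show i - p = (i - 1 - p) + 1 by omega, markov]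

/-- Under a persistently exciting input, a linear relation between the state and the next `M`
inputs that holds along the trajectory vanishes on the reachable space and on the inputs. -/
lemma eq_zero_of_forall_state_add_input_eq_zero (S : StateSpace d) (x₀ : Fin d → ℝ) (u : ℕ → ℝ)
    {M k : ℕ}
    (hu : ∀ w : ℕ → ℝ, (∀ t, t + (d + M) ≤ k →
      ∑ p ∈ Finset.range (d + M), w p * u (t + p) = 0) → ∀ p < d + M, w p = 0)
    (ξ : Fin d → ℝ) (η : ℕ → ℝ)
    (h : ∀ t, t + M ≤ k →
      ξ ⬝ᵥ S.state x₀ u t + ∑ p ∈ Finset.range M, η p * u (t + p) = 0) :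
    (∀ i < d, ξ ⬝ᵥ S.A ^ i *ᵥ S.B = 0) ∧ ∀ p < M, η p = 0 := by
  -- Shifted by j steps, the relation reads ξ A^j x(t) + ∑ W_j(p) u(t+p) = 0. The row W_j read
  -- backwards from p = j+M-1 is θ, which does not depend on j.
  let θ : ℕ → ℝ := fun m => if m < M then η (M - 1 - m) else ξ ⬝ᵥ S.A ^ (m - M) *ᵥ S.B
  let W : ℕ → ℕ → ℝ := fun j p => if p < j + M then θ (j + M - 1 - p) else 0
  let c : ℕ → ℝ := S.A.charpoly.coeff
  have hdeg : S.A.charpoly.natDegree = d := by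
    rw [Matrix.charpoly_natDegree_eq_dim, Fintype.card_fin]
  have hcd : c d = 1 := by
    have := S.A.charpoly_monic.coeff_natDegree
    rwa [hdeg] at this
  have hshift : ∀ t, t + (d + M) ≤ k → ∀ j ≤ d,
      ∑ p ∈ Finset.range (d + M), W j p * u (t + p)
        = -(ξ ⬝ᵥ S.A ^ j *ᵥ S.state x₀ u t) := by
    intro t ht j hj
    have h1 := h (t + j) (by omega)
    rw [dotProduct_state_add] at h1
    have h2 : ∑ p ∈ Finset.range (d + M), W j p * u (t + p)
        = ∑ p ∈ Finset.range (j + M), W j p * u (t + p) := by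
      refine (Finset.sum_subset (Finset.range_mono (by omega)) fun p _ hp => ?_).symm
      rw [Finset.mem_range] at hp
      simp [W, hp]
    have h3 : ∑ p ∈ Finset.range j, W j p * u (t + p)
        = ∑ p ∈ Finset.range j, (ξ ⬝ᵥ S.A ^ (j - 1 - p) *ᵥ S.B) * u (t + p) := by
      refine Finset.sum_congr rfl fun p hp => ?_
      rw [Finset.mem_range] at hp
      simp only [W, θ]
      rw [if_pos (by omega), if_neg (by omega), show j + M - 1 - p - M = j - 1 - p by omega]
    have h4 : ∑ p ∈ Finset.range M, W j (j + p) * u (t + (j + p))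
        = ∑ p ∈ Finset.range M, η p * u (t + j + p) := by
      refine Finset.sum_congr rfl fun p hp => ?_
      rw [Finset.mem_range] at hp
      simp only [W, θ]
      rw [if_pos (by omega), if_pos (by omega), add_assoc,
        show M - 1 - (j + M - 1 - (j + p)) = p by omega]
    rw [h2, Finset.sum_range_add, h3, h4]
    linarith
  -- By Cayley–Hamilton, combining the shifts with the coefficients of the characteristic polynomial
  -- eliminates the state. What remains is a relation among d+M consecutive inputs, which excitation
  -- forces to be trivial.
  have hcomb : ∀ p < d + M, ∑ j ∈ Finset.range (d + 1), c j * W j p = 0 := by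
    refine hu _ fun t ht => ?_
    simp_rw [Finset.sum_mul, mul_assoc]
    rw [Finset.sum_comm]
    simp_rw [← Finset.mul_sum]
    have hCH := S.A.aeval_self_charpoly
    rw [Polynomial.aeval_eq_sum_range, hdeg] at hCH
    calc ∑ j ∈ Finset.range (d + 1), c j * ∑ p ∈ Finset.range (d + M), W j p * u (t + p)
        = ∑ j ∈ Finset.range (d + 1), -(ξ ⬝ᵥ (c j • S.A ^ j) *ᵥ S.state x₀ u t) := by
          refine Finset.sum_congr rfl fun j hj => ?_
          rw [Finset.mem_range] at hj
          rw [hshift t ht j (by omega), Matrix.smul_mulVec, dotProduct_smul, smul_eq_mul, mul_neg]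
      _ = 0 := by
          rw [Finset.sum_neg_distrib, ← dotProduct_sum, ← Matrix.sum_mulVec, hCH]
          simp
  -- The system is triangular with unit diagonal: at p = d+M-1-q the combination is θ(q) plus
  -- multiples of earlier values.
  have hθ : ∀ q < d + M, θ q = 0 := by
    intro q
    induction q using Nat.strong_induction_on with
    | _ q ih =>
      intro hq
      have h1 := hcomb (d + M - 1 - q) (by omega)
      rw [Finset.sum_range_succ, Finset.sum_eq_zero, zero_add, hcd, one_mul] at h1
      · simp only [W] at h1
        rwa [if_pos (by omega), show d + M - 1 - (d + M - 1 - q) = q by omega] at h1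
      · intro j hj
        rw [Finset.mem_range] at hj
        simp only [W]
        split_ifs
        · rw [ih _ (by omega) (by omega), mul_zero]
        · rw [mul_zero]
  constructor
  · intro i hi
    have := hθ (i + M) (by omega)
    simp only [θ] at this
    rwa [if_neg (by omega), Nat.add_sub_cancel] at this
  · intro p hp
    have := hθ (M - 1 - p) (by omega)
    simp only [θ] at this
    rwa [if_pos (by omega), show M - 1 - (M - 1 - p) = p by omega] at this

end StateSpace

lemma Matrix.rank_mul_of_injective_of_linearIndependent {m n o : Type*} [Fintype n] [Fintype o]
    (P : Matrix m n ℝ) (Z : Matrix n o ℝ)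
    (hP : ∀ v, P *ᵥ v = 0 → v = 0) (hZ : ∀ v, v ᵥ* Z = 0 → v = 0) :
    (P * Z).rank = Fintype.card n := by
  classical
  have hrank : Z.rank = Fintype.card n := by
    refine LinearIndependent.rank_matrix ?_
    rw [Fintype.linearIndependent_iff]
    intro g hg i
    refine congrFun (hZ g ?_) i
    rw [Matrix.vecMul_eq_sum]
    exact hg
  have htop : LinearMap.range Z.mulVecLin = ⊤ := by
    refine Submodule.eq_top_of_finrank_eq ?_
    rw [Module.finrank_fintype_fun_eq_card]
    exact hrank
  have hinj : Function.Injective P.mulVecLin := (injective_iff_map_eq_zero _).2 hP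
  rw [Matrix.rank, Matrix.mulVecLin_mul, LinearMap.range_comp_of_range_eq_top _ htop,
    LinearMap.finrank_range_of_inj hinj, Module.finrank_fintype_fun_eq_card]

lemma IsPersistentlyExciting.eq_zero_of_forall_sum_eq_zero {k j : ℕ} {w : Fin k → ℝ}
    (hw : IsPersistentlyExciting j w) {u : ℕ → ℝ} (hu : ∀ t (ht : t < k), u t = w ⟨t, ht⟩)
    (g : ℕ → ℝ) (hg : ∀ t, t + j ≤ k → ∑ p ∈ Finset.range j, g p * u (t + p) = 0) :
    ∀ p < j, g p = 0 := by
  have hli : LinearIndependent ℝ (hankel j w).row := by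
    rw [linearIndependent_iff_card_eq_finrank_span, Fintype.card_fin, Set.finrank,
      ← Matrix.rank_eq_finrank_span_row]
    exact hw.2.symm
  intro p hp
  refine Fintype.linearIndependent_iff.1 hli (fun i => g i) ?_ ⟨p, hp⟩
  funext c
  have hc := c.2
  have h1 := hw.1
  rw [Finset.sum_apply, Pi.zero_apply, ← hg c (by omega), Finset.sum_range]
  refine Finset.sum_congr rfl fun i _ => ?_
  rw [hu _ (by omega)]
  simp [hankel, Matrix.row, add_comm]

/-! ### The two factors of the data matrix -/

namespace StateSpace

variable {d : ℕ}

lemma exists_state_of_mem_trajectories (S : StateSpace d) {T : ℕ}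
    {w : (Fin T → ℝ) × (Fin T → ℝ)} (hw : w ∈ S.trajectories T) :
    ∃ (x₀ : Fin d → ℝ) (u : ℕ → ℝ), (∀ t (ht : t < T), u t = w.1 ⟨t, ht⟩) ∧
      ∀ t (ht : t < T), w.2 ⟨t, ht⟩ = S.C ⬝ᵥ S.state x₀ u t + S.D * u t := by
  obtain ⟨x, hx⟩ := hw
  set u : ℕ → ℝ := fun t => if ht : t < T then w.1 ⟨t, ht⟩ else 0 with hu_def
  have hu : ∀ t (ht : t < T), u t = w.1 ⟨t, ht⟩ := fun t ht => dif_pos ht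
  have hstate : ∀ t ≤ T, S.state (x 0) u t = x t := by
    intro t
    induction t with
    | zero => intro _; rfl
    | succ t ih =>
      intro ht
      rw [state, ih (by omega), hu t (by omega)]
      exact (hx ⟨t, by omega⟩).1.symm
  refine ⟨x 0, u, hu, fun t ht => ?_⟩
  rw [hstate t ht.le, hu t ht]
  exact (hx ⟨t, ht⟩).2

/-- The map from the initial state and the first `m` inputs to the first `a` inputs and the first
`b` outputs. -/
def responseMatrix (S : StateSpace d) (a b m : ℕ) : Matrix (Fin a ⊕ Fin b) (Fin d ⊕ Fin m) ℝ :=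
  Matrix.fromBlocks 0 (Matrix.of fun i p => if (i : ℕ) = p then 1 else 0) (S.obsMatrix b)
    (Matrix.of fun i p => if (p : ℕ) ≤ i then S.markov (i - p) else 0)

lemma responseMatrix_mulVec_inl (S : StateSpace d) {a b m : ℕ} (v : Fin d ⊕ Fin m → ℝ)
    (i : Fin a) (hi : (i : ℕ) < m) :
    (S.responseMatrix a b m *ᵥ v) (Sum.inl i) = v (Sum.inr ⟨i, hi⟩) := by
  simp only [responseMatrix, Matrix.mulVec, dotProduct, Fintype.sum_sum_type,
    Matrix.fromBlocks_apply₁₁, Matrix.fromBlocks_apply₁₂, Matrix.of_apply, Matrix.zero_apply,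
    zero_mul, Finset.sum_const_zero, zero_add]
  rw [Finset.sum_eq_single ⟨i, hi⟩]
  · simp
  · intro p _ hp
    rw [if_neg fun h => hp (Fin.ext h.symm), zero_mul]
  · simp

lemma responseMatrix_mulVec_inr (S : StateSpace d) {a b m : ℕ} (v : Fin d ⊕ Fin m → ℝ)
    (i : Fin b) :
    (S.responseMatrix a b m *ᵥ v) (Sum.inr i)
      = S.C ⬝ᵥ S.A ^ (i : ℕ) *ᵥ (fun j => v (Sum.inl j))
        + ∑ p : Fin m, (if (p : ℕ) ≤ i then S.markov (i - p) else 0) * v (Sum.inr p) := by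
  rw [Matrix.dotProduct_mulVec]
  simp [responseMatrix, Matrix.mulVec, dotProduct, obsMatrix]

/-- The first N+1 inputs vanish, so the first d ≤ N outputs are free responses and observability
kills the state. The remaining inputs are recovered one at a time: output p+ν sees input p through
h_ν, and later inputs only through zero Markov parameters. -/
lemma IsMinimalRealization.responseMatrix_injective {S : StateSpace d} {G : RatFunc ℝ}
    (hS : S.IsMinimalRealization G) {N L ν : ℕ} (hN : d ≤ N) (hL : ν ≤ L)
    (hlt : ∀ i < ν, S.markov i = 0) (hν : S.markov ν ≠ 0)
    (v : Fin d ⊕ Fin (N + L + 1 - ν) → ℝ)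
    (hv : S.responseMatrix (N + 1) (N + L + 1) (N + L + 1 - ν) *ᵥ v = 0) : v = 0 := by
  have hin : ∀ p (hp : p < N + 1), v (Sum.inr ⟨p, by omega⟩) = 0 := by
    intro p hp
    have := congrFun hv (Sum.inl ⟨p, hp⟩)
    rwa [responseMatrix_mulVec_inl _ _ _ (by simp; omega)] at this
  have hout : ∀ i (hi : i < N + L + 1), S.C ⬝ᵥ S.A ^ i *ᵥ (fun j => v (Sum.inl j))
      + ∑ p : Fin (N + L + 1 - ν), (if (p : ℕ) ≤ i then S.markov (i - p) else 0)
        * v (Sum.inr p) = 0 := by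
    intro i hi
    rw [← S.responseMatrix_mulVec_inr (a := N + 1) v ⟨i, hi⟩, hv, Pi.zero_apply]
  have hx : (fun j => v (Sum.inl j)) = 0 := by
    refine hS.observable _ fun i hi => ?_
    have := hout i (by omega)
    rwa [Finset.sum_eq_zero, add_zero] at this
    intro p _
    split_ifs with hpi
    · rw [hin p (by omega), mul_zero]
    · rw [zero_mul]
  have hu : ∀ p (hp : p < N + L + 1 - ν), v (Sum.inr ⟨p, hp⟩) = 0 := by
    intro p
    induction p using Nat.strong_induction_on with
    | _ p ih =>
      intro hp
      have := hout (p + ν) (by omega)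
      rw [hx, Matrix.mulVec_zero, dotProduct_zero, zero_add,
        Finset.sum_eq_single ⟨p, hp⟩] at this
      · rw [if_pos (by simp), Nat.add_sub_cancel_left] at this
        exact (mul_eq_zero.1 this).resolve_left hν
      · intro q _ hq
        rcases lt_trichotomy (q : ℕ) p with h | h | h
        · rw [ih q h q.2, mul_zero]
        · exact absurd (Fin.ext h) hq
        · split_ifs
          · rw [hlt _ (by omega), zero_mul]
          · rw [zero_mul]
      · simp
  funext a
  rcases a with j | p
  · exact congrFun hx j
  · exact hu p p.2

/-- The matrix whose column `t` is the state at time `t` on top of the inputs at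
`t, …, t + m - 1`. -/
def stateInputMatrix (S : StateSpace d) (x₀ : Fin d → ℝ) (u : ℕ → ℝ) (m c : ℕ) :
    Matrix (Fin d ⊕ Fin m) (Fin c) ℝ :=
  Matrix.of fun a t => Sum.elim (fun j => S.state x₀ u t j) (fun p : Fin m => u (t + p)) a

/-- A relation among the rows is padded with zeros to M inputs. Only columns with t+M ≤ k are used;
later columns may reach inputs past time k, about which excitation says nothing, but they cannot
destroy row independence. -/
lemma IsMinimalRealization.vecMul_stateInputMatrix_eq_zero {S : StateSpace d} {G : RatFunc ℝ}
    (hS : S.IsMinimalRealization G) (x₀ : Fin d → ℝ) (u : ℕ → ℝ) {k m M c : ℕ} (hm : m ≤ M)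
    (hc : k < c + M)
    (hu : ∀ w : ℕ → ℝ, (∀ t, t + (d + M) ≤ k →
      ∑ p ∈ Finset.range (d + M), w p * u (t + p) = 0) → ∀ p < d + M, w p = 0)
    (v : Fin d ⊕ Fin m → ℝ) (hv : v ᵥ* S.stateInputMatrix x₀ u m c = 0) : v = 0 := by
  let η : ℕ → ℝ := fun p => if hp : p < m then v (Sum.inr ⟨p, hp⟩) else 0
  obtain ⟨h1, h2⟩ := S.eq_zero_of_forall_state_add_input_eq_zero x₀ u hu
    (fun j => v (Sum.inl j)) η (by
      intro t ht
      have := congrFun hv ⟨t, by omega⟩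
      simp only [Matrix.vecMul, dotProduct, Fintype.sum_sum_type, stateInputMatrix,
        Matrix.of_apply, Sum.elim_inl, Sum.elim_inr, Pi.zero_apply] at this
      rw [← this]
      congr 1
      rw [← Finset.sum_subset (Finset.range_mono hm), Finset.sum_range]
      · refine Finset.sum_congr rfl fun p _ => ?_
        simp [η]
      · intro p _ hp
        rw [Finset.mem_range] at hp
        simp [η, hp])
  have h3 := hS.controllable _ h1
  funext a
  rcases a with j | p
  · exact congrFun h3 j
  · simpa [η] using h2 p (by omega)

end StateSpace

end

theorem lemma4 (G : RatFunc ℝ) (hG : G ≠ 0) (hproper : IsProper G)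
    (n l : ℕ) (hn : IsMinimalOrder G n) (hn0 : 0 < n) (hl : IsLag G l)
    (k L N : ℕ) (hL : relativeDegree G ≤ L) (hN : l ≤ N)
    (ud : Fin k → ℝ) (yd : Fin (k + L) → ℝ) (hdata : (ud, yd) ∈ delayTrajectories G k L)
    (hpe : IsPersistentlyExciting (n + N + L + 1) ud) :
    (stackedHankel N L ud yd).rank = N + n + L - relativeDegree G + 1 := by
  obtain ⟨u', d, S, hS, hw⟩ := hdata
  obtain rfl : d = n := hS.2.unique hn
  obtain ⟨e, S', hS', rfl⟩ := hl
  obtain rfl : e = d := hS'.2.unique hn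
  have hdN : e ≤ N := hS'.le_observabilityIndex.trans hN
  obtain ⟨x₀, u, hu, hy⟩ := S.exists_state_of_mem_trajectories hw
  have hud : ∀ t (ht : t < k), u t = ud ⟨t, ht⟩ := fun t ht => by
    rw [hu t (by omega)]
    exact Fin.append_left ud u' ⟨t, ht⟩
  obtain ⟨hlt, hν⟩ : (∀ i < relativeDegree G, S.markov i = 0) ∧
      S.markov (relativeDegree G) ≠ 0 := by
    have := S.markov_relativeDegree (hS.1.symm ▸ hG)
    rwa [hS.1] at this
  have hexc := hpe.eq_zero_of_forall_sum_eq_zero hud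
  rw [show e + N + L + 1 = e + (N + L + 1) by omega] at hexc
  set ν := relativeDegree G
  have hmul : stackedHankel N L ud yd = S.responseMatrix (N + 1) (N + L + 1) (N + L + 1 - ν)
      * S.stateInputMatrix x₀ u (N + L + 1 - ν) (k + 1 - (N + 1)) := by
    ext a t
    have ht := t.2
    change _ = (S.responseMatrix (N + 1) (N + L + 1) (N + L + 1 - ν)).mulVec
      (fun b => S.stateInputMatrix x₀ u (N + L + 1 - ν) (k + 1 - (N + 1)) b t) a
    rcases a with i | i
    · rw [StateSpace.responseMatrix_mulVec_inl _ _ _ (by omega)]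
      simp only [StateSpace.stateInputMatrix, Matrix.of_apply, Sum.elim_inr]
      rw [hud _ (by omega)]
      simp [stackedHankel, hankel, add_comm]
    · rw [StateSpace.responseMatrix_mulVec_inr]
      simp only [StateSpace.stateInputMatrix, Matrix.of_apply, Sum.elim_inr, Sum.elim_inl]
      have h1 := hy (t + i) (by omega)
      rw [S.output_add] at h1
      have h2 : stackedHankel N L ud yd (Sum.inr i) t = yd ⟨t + i, by omega⟩ := by
        simp [stackedHankel, hankel, add_comm]
      rw [h2]
      refine h1.trans ?_
      congr 1
      have h3 : ∀ m, ∑ p ∈ Finset.range m,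
          (if p ≤ i then S.markov (i - p) else 0) * u (t + p)
          = ∑ p : Fin m, (if (p : ℕ) ≤ i then S.markov (i - p) else 0) * u (t + p) :=
        fun m => Finset.sum_range _
      rw [← h3]
      have h4 : ∑ p ∈ Finset.range (i + 1), S.markov (i - p) * u (t + p)
          = ∑ p ∈ Finset.range (N + L + 1),
            (if p ≤ i then S.markov (i - p) else 0) * u (t + p) := by
        refine Finset.sum_subset_zero_on_sdiff (Finset.range_mono (by omega)) ?_ ?_
        · intro p hp
          rw [Finset.mem_sdiff, Finset.mem_range, Finset.mem_range] at hp
          rw [if_neg (by omega), zero_mul]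
        · intro p hp
          rw [Finset.mem_range] at hp
          rw [if_pos (by omega)]
      rw [h4]
      -- For p ≥ N+L+1-ν and i ≤ N+L the lag i-p is below ν, so the last ν inputs drop out.
      refine (Finset.sum_subset (Finset.range_mono (by omega)) fun p _ hp => ?_).symm
      rw [Finset.mem_range] at hp
      split_ifs
      · rw [hlt _ (by omega), zero_mul]
      · rw [zero_mul]
  rw [hmul, Matrix.rank_mul_of_injective_of_linearIndependent _ _
    (hS.responseMatrix_injective hdN hL hlt hν)
    (hS.vecMul_stateInputMatrix_eq_zero x₀ u (M := N + L + 1) (k := k) (by omega) (by omega) hexc)]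
  simp only [Fintype.card_sum, Fintype.card_fin]
  omega
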